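/- Let $G$ be a finite simple graph on the vertex set $V(G)=\{x_1,\dots,x_n\}$, let $\mathbf{k}$ be a field and let $R=\mathbf{k}[x_1,\dots,x_n]$ be the polynomial ring with its standard grading, whose variables are identified with the vertices of $G$. The closed neighborhood ideal of $G$ is the ideal $$NI(G)=\Big\langle \prod_{x_j\in N[x_i]}x_j \ :\ x_i\in V(G)\Big\rangle\subseteq R,\qquad N[x_i]=\{x_i\}\cup\{x_j : \{x_i,x_j\}\in E(G)\}.$$ Let $a_G$ denote the matching number of $G$, that is, the maximum size of a set of pairwise disjoint edges of $G$. Let $\operatorname{pd}$ denote the projective dimension over $R$, and let $\operatorname{reg}$ denote the Castelnuovo-Mumford regularity: for a finitely generated graded $R$-module $M$, $\operatorname{reg}(M)$ is the maximum of $j-i$ over all pairs $(i,j)$ for which the $i$-th module in the minimal graded free resolution of $M$ has a basis element of degree $j$. If $G$ is a forest, then $$\operatorname{reg}(R/NI(G))\ \ge\ a_G\qquad\text{and}\qquad \operatorname{pd}(R/NI(G))\ \ge\ a_G .$$ -/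

import Mathlib

open scoped Classical in
/-- The matching number of a finite graph: the largest cardinality of a set of pairwise
disjoint edges. -/
noncomputable def SimpleGraph.matchingNum {V : Type*} [Fintype V] (G : SimpleGraph V) : ℕ :=
  (Finset.univ.filter fun M : Finset (Sym2 V) =>
    (∀ e ∈ M, e ∈ G.edgeSet) ∧
      ∀ e ∈ M, ∀ f ∈ M, e ≠ f → ∀ v, ¬ (v ∈ e ∧ v ∈ f)).sup Finset.card

open scoped Classical in
/-- The closed neighborhood ideal of `G` in `k[x_v : v ∈ V]`, generated by the monomials
`∏_{w ∈ N[v]} x_w`, one for each vertex `v`, where `N[v] = {v} ∪ {w | w adjacent to v}`. -/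
noncomputable def SimpleGraph.closedNeighborhoodIdeal {V : Type*} [Fintype V]
    (G : SimpleGraph V) (k : Type*) [Field k] : Ideal (MvPolynomial V k) :=
  Ideal.span (Set.range fun v : V =>
    ∏ w ∈ Finset.univ.filter (fun w : V => w = v ∨ G.Adj v w), MvPolynomial.X w)

namespace GradedReg

/-- The homogeneous component of degree `d : ℤ` of the polynomial ring with its standard grading
(it is `0` for `d < 0`). -/
noncomputable def homogeneousPart (V k : Type*) [Field k] (d : ℤ) : AddSubgroup (MvPolynomial V k) where
  carrier := {p | ∀ m : V →₀ ℕ, p.coeff m ≠ 0 → (m.degree : ℤ) = d}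
  zero_mem' := by simp
  add_mem' := by
    intro p q hp hq m hm
    by_cases h : p.coeff m = 0
    · exact hq m fun h' => hm (by simp [h, h'])
    · exact hp m h
  neg_mem' := by
    intro p hp m hm
    exact hp m fun h => hm (by simp [h])

/-- The grading on a quotient `k[x_v : v ∈ V] / I` (meaningful for a homogeneous ideal `I`):
the component of degree `d` is the image of the component of degree `d` of the polynomial ring. -/
noncomputable def quotientPart {V k : Type*} [Field k] (I : Ideal (MvPolynomial V k)) (d : ℤ) :
    AddSubgroup (MvPolynomial V k ⧸ I) :=
  (homogeneousPart V k d).map (Ideal.Quotient.mk I : MvPolynomial V k →+ MvPolynomial V k ⧸ I)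

/-- A minimal graded free resolution
`⋯ → F₂ → F₁ → F₀ → M → 0` of a graded module `M` with components `gr d`, over the standard graded
polynomial ring `R = k[x_v : v ∈ V]`. The module `F i` is the free module `Fin (rank i) → R` of
finite rank, whose basis vector `e_l` is placed in degree `deg i l`; in other words
`F i = ⨁_l R(-deg i l)`. -/
structure MinimalFreeResolution (V k : Type*) [Field k] (M : Type*) [AddCommGroup M]
    [Module (MvPolynomial V k) M] (gr : ℤ → AddSubgroup M) where
  /-- the rank of `F i` -/
  rank : ℕ → ℕ
  /-- the degrees of the basis vectors of `F i` -/
  deg : (i : ℕ) → Fin (rank i) → ℤ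
  /-- the differential `F (i + 1) → F i` -/
  d : (i : ℕ) → (Fin (rank (i + 1)) → MvPolynomial V k) →ₗ[MvPolynomial V k]
    (Fin (rank i) → MvPolynomial V k)
  /-- the augmentation `F 0 → M` -/
  aug : (Fin (rank 0) → MvPolynomial V k) →ₗ[MvPolynomial V k] M
  /-- the differentials preserve degrees -/
  d_homogeneous : ∀ i l m, d i (Pi.single l 1) m ∈ homogeneousPart V k (deg (i + 1) l - deg i m)
  /-- the augmentation preserves degrees -/
  aug_homogeneous : ∀ l, aug (Pi.single l 1) ∈ gr (deg 0 l)
  aug_surjective : Function.Surjective aug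
  exact_zero : LinearMap.range (d 0) = LinearMap.ker aug
  exact_succ : ∀ i, LinearMap.range (d (i + 1)) = LinearMap.ker (d i)
  /-- minimality: the matrix entries of the differentials lie in the ideal `(x_v : v ∈ V)` -/
  minimal : ∀ i l m, MvPolynomial.constantCoeff (d i (Pi.single l 1) m) = 0

/-- The Castelnuovo-Mumford regularity of a finitely generated graded module `M` over the standard
graded polynomial ring `k[x_v : v ∈ V]`, `V` finite: the supremum of `j - i` over all pairs `(i, j)`
such that the `i`-th module of the minimal graded free resolution of `M` has a basis element of
degree `j`, i.e. such that the graded Betti number `β_{i,j}(M)` is nonzero. (All minimal graded free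
resolutions have the same ranks and degrees, so the supremum over resolutions is harmless; the
regularity of the zero module is `-∞`.) -/
noncomputable def regularity (V k : Type*) [Field k] (M : Type*) [AddCommGroup M]
    [Module (MvPolynomial V k) M] (gr : ℤ → AddSubgroup M) : EReal :=
  ⨆ (F : MinimalFreeResolution V k M gr) (i : ℕ) (l : Fin (F.rank i)),
    ((((F.deg i l - (i : ℤ) : ℤ) : ℝ)) : EReal)

end GradedReg

/-! ### Forests: vertex covers matched into their complement -/

namespace SimpleGraph

variable {V : Type*} [Fintype V]

/-! In a forest, König's theorem gives a vertex cover `B = {b_j}` of size `q ≥ a_G`, matched into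
its complement by edges `b_j a_j`. Put `I = NI(G)`. Every closed neighborhood contains some `{a_j,
b_j}` or an unmatched vertex, so `I` lies in the complete intersection `J` of the `x_{a_j} x_{b_j}`
and the unmatched variables. Since `N[a_j] ⊆ {a_j} ∪ B`, the class of `x_B = ∏ x_{b_j}` in `R/I` is
killed by every `x_{a_j}`.

Let `F` be a minimal resolution of `R/I`. The Koszul complex on the `x_{a_j}` maps to `F`, with `1`
sent to a lift of `x_B`; `F` maps towards the Koszul complex of `J`. Tracking one monomial
coefficient through the composite, each step trades a factor `x_{b_j}` for one homological degree,
until a nonzero constant is left in degree `q`. So some element of `F_q` of degree `q + q` has a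
unit coordinate, and `F_q` has a generator of degree `2q`.

This gives `reg ≥ 2q - q = q`. It also gives `F_q ≠ 0`, hence `pd ≥ q`, because a minimal resolution
vanishes from the first homological degree exceeding the projective dimension. -/

theorem IsAcyclic.exists_leaf {G : SimpleGraph V} (hG : G.IsAcyclic) {x y : V} (hxy : G.Adj x y) :
    ∃ a b, G.Adj a b ∧ ∀ w, G.Adj a w → w = b := by
  let S : Set ℕ := {n | ∃ (u v : V) (p : G.Walk u v), p.IsPath ∧ p.length = n}
  have hne : S.Nonempty := ⟨1, x, y, hxy.toWalk, by simp [hxy.ne], by simp⟩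
  have hbdd : BddAbove S := by
    refine ⟨Fintype.card V, ?_⟩
    rintro n ⟨u, v, p, hp, rfl⟩
    exact hp.length_lt.le
  -- The start of a longest path is a leaf: another neighbor would close a cycle or extend the path.
  obtain ⟨u, v, p, hp, hlen⟩ := Nat.sSup_mem hne hbdd
  have h1 : 1 ≤ p.length := by
    rw [hlen]
    exact le_csSup hbdd ⟨x, y, hxy.toWalk, by simp [hxy.ne], by simp⟩
  have hnil : ¬ p.Nil := by
    intro h
    have := Walk.length_eq_zero_iff.mpr h
    omega
  refine ⟨u, p.snd, p.adj_snd hnil, fun w hw => ?_⟩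
  by_cases hmem : w ∈ p.support
  · exact (hG.eq_snd_of_adj_start hp hw hmem)
  · exfalso
    have hcons : (Walk.cons hw.symm p).IsPath := by simp [hp, hmem]
    have := le_csSup hbdd (show (Walk.cons hw.symm p).length ∈ S from ⟨w, v, _, hcons, rfl⟩)
    rw [Walk.length_cons, hlen] at this
    omega

/-- König's theorem for forests: there is a vertex cover which is matched into its complement. -/
theorem IsAcyclic.exists_isVertexCover_matched (G : SimpleGraph V) (hG : G.IsAcyclic) :
    ∃ (B : Finset V) (α : V → V), Set.InjOn α B ∧ (∀ b ∈ B, α b ∉ B) ∧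
      (∀ b ∈ B, G.Adj b (α b)) ∧ G.IsVertexCover B := by
  classical
  induction G using WellFoundedLT.induction with
  | ind G ih =>
  by_cases hE : ∃ x y, G.Adj x y
  · obtain ⟨x, y, hxy⟩ := hE
    obtain ⟨a, b, hab, ha⟩ := hG.exists_leaf hxy
    -- The neighbor `b` of the leaf `a` joins the cover, matched to `a`. Deleting the edges at `b`
    -- isolates `a`, so the inductive matching avoids both.
    let H : SimpleGraph V := G.deleteIncidenceSet b
    have hH : ∀ {u v}, H.Adj u v ↔ G.Adj u v ∧ u ≠ b ∧ v ≠ b := by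
      intro u v
      exact G.deleteIncidenceSet_adj
    have hle : H ≤ G := fun u v h => (hH.mp h).1
    have hlt : H < G := lt_of_le_of_ne hle fun h => by
      exact (hH.mp (h.symm ▸ hab)).2.2 rfl
    obtain ⟨B, α, hinj, hnot, hadj, hcov⟩ := ih H hlt (hG.anti hle)
    have hb : b ∉ B := fun h => (hH.mp (hadj b h)).2.1 rfl
    have hHa : ∀ w, ¬ H.Adj a w := fun w h => (hH.mp h).2.2 (ha w (hH.mp h).1)
    have haB : a ∉ B := fun h => hHa _ (hadj a h)
    have hne : ∀ c ∈ B, c ≠ b := fun c hc h => hb (h ▸ hc)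
    have hαa : ∀ c ∈ B, α c ≠ a := fun c hc h => hHa c (h ▸ (hadj c hc).symm)
    have hαb : ∀ c ∈ B, α c ≠ b := fun c hc h => (hH.mp (hadj c hc)).2.2 h
    have hup : ∀ c ∈ B, Function.update α b a c = α c := fun c hc =>
      Function.update_of_ne (hne c hc) _ _
    refine ⟨insert b B, Function.update α b a, ?_, ?_, ?_, ?_⟩
    · rw [Finset.coe_insert, Set.injOn_insert (by simpa using hb)]
      refine ⟨fun c hc d hd h => ?_, ?_⟩
      · rw [hup c hc, hup d hd] at h
        exact hinj hc hd h
      · rintro ⟨c, hc, h⟩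
        rw [hup c hc, Function.update_self] at h
        exact hαa c hc h
    · intro c hc
      rcases Finset.mem_insert.mp hc with rfl | hc
      · simp [haB, hab.ne]
      · simp [hup c hc, hαb c hc, hnot c hc]
    · intro c hc
      rcases Finset.mem_insert.mp hc with rfl | hc
      · simpa using hab.symm
      · rw [hup c hc]
        exact hle (hadj c hc)
    · intro u v huv
      by_cases hu : u = b
      · simp [hu]
      by_cases hv : v = b
      · simp [hv]
      rcases hcov (hH.mpr ⟨huv, hu, hv⟩) with h | h
      · exact Or.inl (by simpa using Or.inr h)
      · exact Or.inr (by simpa using Or.inr h)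
  · push Not at hE
    exact ⟨∅, id, by simp, by simp, by simp, fun u v h => (hE u v h).elim⟩

/-- Disjoint edges choose distinct vertices of the cover. -/
theorem IsVertexCover.matchingNum_le {G : SimpleGraph V} {B : Finset V}
    (hB : G.IsVertexCover B) : G.matchingNum ≤ B.card := by
  classical
  refine Finset.sup_le fun M hM => ?_
  obtain ⟨hM1, hM2⟩ := (Finset.mem_filter.mp hM).2
  have hex : ∀ e, ∃ v, e ∈ M → v ∈ B ∧ v ∈ e := by
    intro e
    induction e using Sym2.ind with
    | _ u v =>
      by_cases h : u ∈ B
      · exact ⟨u, fun _ => ⟨h, by simp⟩⟩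
      · exact ⟨v, fun he => ⟨by simpa [h] using hB (hM1 _ he), by simp⟩⟩
  choose f hf using hex
  refine Finset.card_le_card_of_injOn f (fun e he => (hf e he).1) fun e he e' he' h => ?_
  by_contra hne
  exact hM2 e he e' he' hne (f e) ⟨(hf e he).2, h ▸ (hf e' he').2⟩

end SimpleGraph

/-! ### Graded free modules and existence of minimal resolutions -/

namespace GradedReg

open MvPolynomial

variable {V k : Type*} [Field k]

/-- The homogeneous component of degree `d : ℤ` of a polynomial. -/
noncomputable def component (d : ℤ) : MvPolynomial V k →ₗ[k] MvPolynomial V k :=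
  weightedHomogeneousComponent (fun _ => (1 : ℤ)) d

theorem weight_one_eq_degree (m : V →₀ ℕ) :
    Finsupp.weight (fun _ : V => (1 : ℤ)) m = (m.degree : ℤ) := by
  simp [Finsupp.weight_apply, Finsupp.degree_apply, Finsupp.sum]

theorem coeff_component (d : ℤ) (p : MvPolynomial V k) (m : V →₀ ℕ) :
    (component d p).coeff m = if (m.degree : ℤ) = d then p.coeff m else 0 := by
  classical
  rw [component, coeff_weightedHomogeneousComponent, weight_one_eq_degree]

theorem mem_homogeneousPart {d : ℤ} {p : MvPolynomial V k} :
    p ∈ homogeneousPart V k d ↔ ∀ m : V →₀ ℕ, p.coeff m ≠ 0 → (m.degree : ℤ) = d := Iff.rfl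

theorem component_mem (d : ℤ) (p : MvPolynomial V k) : component d p ∈ homogeneousPart V k d := by
  intro m hm
  by_contra h
  exact hm (by rw [coeff_component, if_neg h])

theorem component_of_mem {d : ℤ} {p : MvPolynomial V k} (hp : p ∈ homogeneousPart V k d) (e : ℤ) :
    component e p = if d = e then p else 0 := by
  ext m
  rw [coeff_component]
  by_cases h : p.coeff m = 0
  · split_ifs <;> simp [h]
  · rw [mem_homogeneousPart.mp hp m h]
    split_ifs <;> simp

theorem component_self {d : ℤ} {p : MvPolynomial V k} (hp : p ∈ homogeneousPart V k d) :
    component d p = p := by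
  rw [component_of_mem hp, if_pos rfl]

theorem mul_mem_homogeneousPart {d e : ℤ} {p q : MvPolynomial V k}
    (hp : p ∈ homogeneousPart V k d) (hq : q ∈ homogeneousPart V k e) :
    p * q ∈ homogeneousPart V k (d + e) := by
  classical
  intro m hm
  rw [coeff_mul] at hm
  obtain ⟨⟨x, y⟩, hx, hxy⟩ := Finset.exists_ne_zero_of_sum_ne_zero hm
  rw [Finset.HasAntidiagonal.mem_antidiagonal] at hx
  subst hx
  rw [map_add, Nat.cast_add, hp x (left_ne_zero_of_mul hxy), hq y (right_ne_zero_of_mul hxy)]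

theorem monomial_mem_homogeneousPart (m : V →₀ ℕ) (a : k) :
    monomial m a ∈ homogeneousPart V k m.degree := by
  classical
  intro n hn
  rw [coeff_monomial] at hn
  split_ifs at hn with h
  · rw [h]
  · exact (hn rfl).elim

theorem X_mem_homogeneousPart (v : V) : (X v : MvPolynomial V k) ∈ homogeneousPart V k 1 := by
  simpa using! monomial_mem_homogeneousPart (Finsupp.single v 1) (1 : k)

theorem one_mem_homogeneousPart : (1 : MvPolynomial V k) ∈ homogeneousPart V k 0 := by
  simpa using! monomial_mem_homogeneousPart (0 : V →₀ ℕ) (1 : k)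

theorem component_mul {e : ℤ} (p : MvPolynomial V k) {q : MvPolynomial V k}
    (hq : q ∈ homogeneousPart V k e) (d : ℤ) :
    component d (p * q) = component (d - e) p * q := by
  induction p using MvPolynomial.induction_on' with
  | monomial m a =>
    have hm := monomial_mem_homogeneousPart m a
    rw [component_of_mem hm, component_of_mem (mul_mem_homogeneousPart hm hq)]
    by_cases h : (m.degree : ℤ) = d - e
    · rw [if_pos h, if_pos (by omega)]
    · rw [if_neg h, if_neg (by omega), zero_mul]
  | add p p' hp hp' => rw [add_mul, map_add, map_add, hp, hp', add_mul]

/-- The homogeneous component of degree `D` of a vector, where the `l`-th basis vector of the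
free module has degree `δ l`. -/
noncomputable def vecComponent {r : ℕ} (δ : Fin r → ℤ) (D : ℤ) (v : Fin r → MvPolynomial V k) :
    Fin r → MvPolynomial V k := fun l => component (D - δ l) (v l)

/-- Homogeneity of degree `D` of a vector, where the `l`-th basis vector has degree `δ l`. -/
def IsHom {r : ℕ} (δ : Fin r → ℤ) (D : ℤ) (v : Fin r → MvPolynomial V k) : Prop :=
  ∀ l, v l ∈ homogeneousPart V k (D - δ l)

section vec

variable {r s : ℕ} {δ : Fin r → ℤ} {ε : Fin s → ℤ}

theorem isHom_vecComponent (D : ℤ) (v : Fin r → MvPolynomial V k) :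
    IsHom δ D (vecComponent δ D v) := fun _ => component_mem _ _

theorem IsHom.vecComponent_eq {D : ℤ} {v : Fin r → MvPolynomial V k} (hv : IsHom δ D v) :
    vecComponent δ D v = v := funext fun l => component_self (hv l)

theorem IsHom.smul {D e : ℤ} {v : Fin r → MvPolynomial V k} (hv : IsHom δ D v)
    {p : MvPolynomial V k} (hp : p ∈ homogeneousPart V k e) : IsHom δ (e + D) (p • v) := by
  intro l
  rw [add_sub_assoc]
  exact mul_mem_homogeneousPart hp (hv l)

theorem IsHom.sum {ι : Type*} (t : Finset ι) {D : ℤ} {v : ι → Fin r → MvPolynomial V k}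
    (hv : ∀ i ∈ t, IsHom δ D (v i)) : IsHom δ D (∑ i ∈ t, v i) := by
  intro l
  rw [Finset.sum_apply]
  exact AddSubgroup.sum_mem _ fun i hi => hv i hi l

/-- Degree-preserving maps commute with taking components, so any lift of a homogeneous element can
be replaced by a homogeneous one. -/
theorem map_vecComponent {f : (Fin r → MvPolynomial V k) →ₗ[MvPolynomial V k]
      (Fin s → MvPolynomial V k)} (hf : ∀ l, IsHom ε (δ l) (f (Pi.single l 1)))
    (D : ℤ) (v : Fin r → MvPolynomial V k) :
    f (vecComponent δ D v) = vecComponent ε D (f v) := by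
  rw [LinearMap.pi_apply_eq_sum_univ f v, LinearMap.pi_apply_eq_sum_univ f (vecComponent δ D v)]
  ext1 m
  simp only [vecComponent, Finset.sum_apply, Pi.smul_apply, smul_eq_mul, map_sum]
  refine Finset.sum_congr rfl fun l _ => ?_
  have h := hf l m
  have hfun : (fun j => if l = j then (1 : MvPolynomial V k) else 0) = Pi.single l 1 := by
    ext1 j
    simp [Pi.single_apply, eq_comm]
  rw [hfun, component_mul _ h]
  congr 2
  ring_nf

theorem map_vecComponent_ring {f : (Fin r → MvPolynomial V k) →ₗ[MvPolynomial V k]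
      MvPolynomial V k} (hf : ∀ l, f (Pi.single l 1) ∈ homogeneousPart V k (δ l))
    (D : ℤ) (v : Fin r → MvPolynomial V k) :
    f (vecComponent δ D v) = component D (f v) := by
  have := map_vecComponent (f := LinearMap.pi fun _ : Fin 1 => f) (δ := δ) (ε := fun _ => 0)
    (fun l m => by simpa using hf l) D v
  simpa [vecComponent] using congrFun this 0

/-- A submodule containing the homogeneous components of its elements. -/
def IsHomSubmodule (δ : Fin r → ℤ)
    (N : Submodule (MvPolynomial V k) (Fin r → MvPolynomial V k)) : Prop :=
  ∀ v ∈ N, ∀ D, vecComponent δ D v ∈ N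

theorem exists_sum_vecComponent (δ : Fin r → ℤ) (v : Fin r → MvPolynomial V k) :
    ∃ t : Finset ℤ, v = ∑ D ∈ t, vecComponent δ D v := by
  classical
  refine ⟨Finset.univ.biUnion fun l =>
    (v l).support.image fun m => (m.degree : ℤ) + δ l, ?_⟩
  ext l m
  rw [Finset.sum_apply, coeff_sum]
  simp only [vecComponent, coeff_component]
  by_cases h : (v l).coeff m = 0
  · simp [h]
  · rw [Finset.sum_eq_single ((m.degree : ℤ) + δ l)]
    · simp
    · intro D _ hD
      rw [if_neg]
      omega
    · intro hn
      exact (hn (Finset.mem_biUnion.mpr ⟨l, Finset.mem_univ _,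
        Finset.mem_image.mpr ⟨m, mem_support_iff.mpr h, rfl⟩⟩)).elim

theorem IsHomSubmodule.span_eq {N : Submodule (MvPolynomial V k) (Fin r → MvPolynomial V k)}
    (hN : IsHomSubmodule δ N) :
    Submodule.span (MvPolynomial V k) {v | v ∈ N ∧ ∃ D, IsHom δ D v} = N := by
  refine le_antisymm (Submodule.span_le.mpr fun v hv => hv.1) fun v hv => ?_
  obtain ⟨t, ht⟩ := exists_sum_vecComponent δ v
  rw [ht]
  exact Submodule.sum_mem _ fun D _ =>
    Submodule.subset_span ⟨hN v hv D, D, isHom_vecComponent D v⟩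

theorem isHomSubmodule_ker {f : (Fin r → MvPolynomial V k) →ₗ[MvPolynomial V k]
      (Fin s → MvPolynomial V k)} (hf : ∀ l, IsHom ε (δ l) (f (Pi.single l 1))) :
    IsHomSubmodule δ (LinearMap.ker f) := by
  intro v hv D
  rw [LinearMap.mem_ker] at hv ⊢
  rw [map_vecComponent hf, hv]
  ext1 l
  simp [vecComponent]

/-- A finitely generated graded submodule has a minimal graded free cover. -/
theorem IsHomSubmodule.exists_minimal_cover [Finite V]
    {N : Submodule (MvPolynomial V k) (Fin r → MvPolynomial V k)} (hN : IsHomSubmodule δ N) :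
    ∃ (s : ℕ) (ε : Fin s → ℤ) (f : (Fin s → MvPolynomial V k) →ₗ[MvPolynomial V k]
      (Fin r → MvPolynomial V k)), (∀ l, IsHom δ (ε l) (f (Pi.single l 1))) ∧
      LinearMap.range f = N ∧ ∀ c ∈ LinearMap.ker f, ∀ l, constantCoeff (c l) = 0 := by
  classical
  have hfg : (Submodule.span (MvPolynomial V k) {v | v ∈ N ∧ ∃ D, IsHom δ D v}).FG :=
    IsNoetherian.noetherian _
  rw [Submodule.fg_span_iff_fg_span_finset_subset] at hfg
  obtain ⟨t, ht, hspan⟩ := hfg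
  rw [hN.span_eq] at hspan
  -- Minimality comes from a homogeneous generating set of least cardinality.
  let P : ℕ → Prop := fun n => ∃ t : Finset (Fin r → MvPolynomial V k), t.card = n ∧
    (∀ v ∈ t, ∃ D, IsHom δ D v) ∧ Submodule.span (MvPolynomial V k) (t : Set _) = N
  have hP : ∃ n, P n := ⟨_, t, rfl, fun v hv => (ht hv).2, hspan.symm⟩
  obtain ⟨t, htc, hth, hspan⟩ := Nat.find_spec hP
  have hmin : ∀ u : Finset (Fin r → MvPolynomial V k), u ⊂ t →
      Submodule.span (MvPolynomial V k) (u : Set _) ≠ N := fun u hu h =>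
    Nat.find_min hP (htc ▸ Finset.card_lt_card hu) ⟨u, rfl, fun v hv => hth v (hu.1 hv), h⟩
  clear htc
  let e := t.equivFin.symm
  have hg : ∀ l, ∃ D, IsHom δ D (e l : Fin r → MvPolynomial V k) := fun l => hth _ (e l).2
  choose ε hε using hg
  let f : (Fin t.card → MvPolynomial V k) →ₗ[MvPolynomial V k] (Fin r → MvPolynomial V k) :=
    Fintype.linearCombination (MvPolynomial V k) fun l => (e l : Fin r → MvPolynomial V k)
  have hf1 : ∀ l, f (Pi.single l 1) = e l := fun l => by
    simp only [f]
    rw [Fintype.linearCombination_apply_single, one_smul]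
  have hfh : ∀ l, IsHom δ (ε l) (f (Pi.single l 1)) := fun l => by
    rw [hf1]
    exact hε l
  refine ⟨t.card, ε, f, hfh, ?_, ?_⟩
  · rw [Fintype.range_linearCombination, ← hspan]
    congr 1
    ext v
    constructor
    · rintro ⟨l, rfl⟩
      exact (e l).2
    · exact fun hv => ⟨e.symm ⟨v, hv⟩, by simp⟩
  · intro c hc l
    by_contra hne
    -- The component in degree `ε l` turns the `l`-th coordinate of the relation into a nonzero
    -- constant, which makes the `l`-th generator redundant.
    have hc' := isHomSubmodule_ker hfh c hc (ε l)
    set c' := vecComponent ε (ε l) c with hc'def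
    have hcl : c' l = C (constantCoeff (c l)) := by
      ext m
      rw [hc'def, vecComponent, sub_self, coeff_component, coeff_C]
      by_cases hm : m = 0
      · subst hm
        simp [constantCoeff_eq]
      · have : m.degree ≠ 0 := mt (Finsupp.degree_eq_zero_iff m).mp hm
        rw [if_neg (by exact_mod_cast this), if_neg (Ne.symm hm)]
    have hsum : ∑ j, c' j • (e j : Fin r → MvPolynomial V k) = 0 := by
      simpa [f, Fintype.linearCombination_apply] using hc'
    rw [← Finset.add_sum_erase _ _ (Finset.mem_univ l)] at hsum
    have hmem : (e l : Fin r → MvPolynomial V k) ∈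
        Submodule.span (MvPolynomial V k) ((t.erase (e l) : Finset _) : Set _) := by
      have h1 : (e l : Fin r → MvPolynomial V k) =
          (C (constantCoeff (c l))⁻¹ : MvPolynomial V k) •
            -∑ j ∈ Finset.univ.erase l, c' j • (e j : Fin r → MvPolynomial V k) := by
        rw [← eq_neg_of_add_eq_zero_left hsum, smul_smul, hcl, ← C_mul,
          inv_mul_cancel₀ hne, C_1, one_smul]
      refine SetLike.mem_coe.mp (Set.mem_of_eq_of_mem h1 (Submodule.smul_mem _ _
        (Submodule.neg_mem _ (Submodule.sum_mem _ fun j hj =>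
          Submodule.smul_mem _ _ (Submodule.subset_span ?_)))))
      rw [Finset.mem_coe, Finset.mem_erase]
      exact ⟨fun h => (Finset.mem_erase.mp hj).1 (e.injective (Subtype.ext h)), (e j).2⟩
    refine hmin _ (Finset.erase_ssubset (e l).2) ?_
    rw [← hspan]
    refine le_antisymm (Submodule.span_mono (by simp)) (Submodule.span_le.mpr fun v hv => ?_)
    by_cases hvl : v = e l
    · rw [hvl]
      exact hmem
    · exact Submodule.subset_span (by simpa [hvl] using hv)

end vec

/-- Dependent choice along a sequence of types. -/
theorem exists_seq_of_step {T : ℕ → Type*} {R : ∀ i, T i → T (i + 1) → Prop} (t₀ : T 0)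
    (h : ∀ i t, ∃ t', R i t t') : ∃ f : ∀ i, T i, f 0 = t₀ ∧ ∀ i, R i (f i) (f (i + 1)) := by
  choose g hg using h
  exact ⟨fun i => Nat.rec t₀ g i, rfl, fun i => hg i _⟩

/-- A graded submodule of a graded free module which is contained in the maximal graded
ideal times the free module. -/
structure GradedSubmodule (V k : Type*) [Field k] where
  /-- the rank of the ambient free module -/
  rank : ℕ
  /-- the degrees of the basis vectors -/
  deg : Fin rank → ℤ
  /-- the submodule -/
  N : Submodule (MvPolynomial V k) (Fin rank → MvPolynomial V k)
  isHom : IsHomSubmodule deg N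
  minimal : ∀ v ∈ N, ∀ l, constantCoeff (v l) = 0

/-- The regularity is a supremum over resolutions, so a lower bound needs one to exist. It is built
by iterated minimal covers of kernels, starting from `R → R/I`; `hI0` makes this first cover
minimal. -/
theorem nonempty_minimalFreeResolution [Finite V] {I : Ideal (MvPolynomial V k)}
    (hI : ∀ p ∈ I, ∀ D, component D p ∈ I) (hI0 : ∀ p ∈ I, constantCoeff p = 0) :
    Nonempty (MinimalFreeResolution V k (MvPolynomial V k ⧸ I) (quotientPart I)) := by
  let pr : (Fin 1 → MvPolynomial V k) →ₗ[MvPolynomial V k] (MvPolynomial V k ⧸ I) :=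
    I.mkQ ∘ₗ LinearMap.proj 0
  have hpr : ∀ v, v ∈ LinearMap.ker pr ↔ v 0 ∈ I := fun v => by
    simp [pr, Ideal.Quotient.eq_zero_iff_mem]
  let t₀ : GradedSubmodule V k :=
    { rank := 1
      deg := fun _ => 0
      N := LinearMap.ker pr
      isHom := fun v hv D => (hpr _).mpr (hI _ ((hpr v).mp hv) _)
      minimal := fun v hv l => by
        rw [Subsingleton.elim l 0]
        exact hI0 _ ((hpr v).mp hv) }
  obtain ⟨f, hf0, hf⟩ := exists_seq_of_step (T := fun _ => GradedSubmodule V k)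
    (R := fun _ t t' => ∃ g : (Fin t'.rank → MvPolynomial V k) →ₗ[MvPolynomial V k]
      (Fin t.rank → MvPolynomial V k), (∀ l, IsHom t.deg (t'.deg l) (g (Pi.single l 1))) ∧
      LinearMap.range g = t.N ∧ LinearMap.ker g = t'.N) t₀ (by
    intro _ t
    obtain ⟨s, ε, g, hg1, hg2, hg3⟩ := t.isHom.exists_minimal_cover
    exact ⟨⟨s, ε, LinearMap.ker g, isHomSubmodule_ker hg1, hg3⟩, g, hg1, hg2, rfl⟩)
  choose g hg1 hg2 hg3 using hf
  obtain ⟨aug, haug1, haug2, haug3⟩ : ∃ aug : (Fin (f 0).rank → MvPolynomial V k)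
      →ₗ[MvPolynomial V k] (MvPolynomial V k ⧸ I),
      (∀ l, aug (Pi.single l 1) ∈ quotientPart I ((f 0).deg l)) ∧ Function.Surjective aug ∧
        LinearMap.ker aug = (f 0).N := by
    rw [hf0]
    refine ⟨pr, fun l => ⟨1, one_mem_homogeneousPart, ?_⟩, ?_, rfl⟩
    · have : l = 0 := Subsingleton.elim (α := Fin 1) _ _
      subst this
      simp [pr, t₀]
    · exact I.mkQ_surjective.comp fun p => ⟨fun _ => p, rfl⟩
  exact ⟨{
    rank := fun i => (f i).rank
    deg := fun i => (f i).deg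
    d := g
    aug := aug
    d_homogeneous := fun i l m => hg1 i l m
    aug_homogeneous := haug1
    aug_surjective := haug2
    exact_zero := by rw [hg2, haug3]
    exact_succ := fun i => by rw [hg2, hg3]
    minimal := fun i l m => (f i).minimal _ (by rw [← hg2]; exact ⟨_, rfl⟩) m }⟩

end GradedReg

namespace GradedReg

open MvPolynomial

/-! ### The Koszul differential and its lift to a resolution -/

section Koszul

variable {R M N : Type*} [CommRing R] [AddCommGroup M] [Module R M] [AddCommGroup N] [Module R N]

/-- The sign of the face `S.erase j` in the Koszul differential of the face `S`. -/
def koszulSign (R : Type*) [CommRing R] (j : ℕ) (S : Finset ℕ) : R :=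
  (-1) ^ (S.filter (· < j)).card

/-- The Koszul differential, dualized to families of vectors indexed by finite sets. -/
def koszulBoundary (y : ℕ → R) (w : Finset ℕ → M) (S : Finset ℕ) : M :=
  ∑ j ∈ S, (koszulSign R j S * y j) • w (S.erase j)

theorem koszulBoundary_congr (y : ℕ → R) {w w' : Finset ℕ → M} {S : Finset ℕ}
    (h : ∀ j ∈ S, w (S.erase j) = w' (S.erase j)) :
    koszulBoundary y w S = koszulBoundary y w' S :=
  Finset.sum_congr rfl fun j hj => by rw [h j hj]

theorem map_koszulBoundary (f : M →ₗ[R] N) (y : ℕ → R) (w : Finset ℕ → M) (S : Finset ℕ) :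
    f (koszulBoundary y w S) = koszulBoundary y (fun T => f (w T)) S := by
  simp [koszulBoundary, map_sum]

/-- Removing the larger of two elements does not change how many lie below the smaller; removing the
smaller lowers the count below the larger by one. -/
theorem koszulSign_swap {i j : ℕ} {S : Finset ℕ} (hi : i ∈ S) (hj : j ∈ S) (hij : i ≠ j) :
    koszulSign R j S * koszulSign R i (S.erase j) +
      koszulSign R i S * koszulSign R j (S.erase i) = 0 := by
  have key : ∀ {i j : ℕ}, i ∈ S → i < j → koszulSign R j S * koszulSign R i (S.erase j) +
      koszulSign R i S * koszulSign R j (S.erase i) = 0 := by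
    intro i j hi hlt
    have h1 : (S.erase j).filter (· < i) = S.filter (· < i) := by
      ext x
      simp only [Finset.mem_filter, Finset.mem_erase]
      constructor
      · exact fun h => ⟨h.1.2, h.2⟩
      · exact fun h => ⟨⟨by omega, h.1⟩, h.2⟩
    have h2 : (S.filter (· < j)).card = ((S.erase i).filter (· < j)).card + 1 := by
      rw [Finset.filter_erase, Finset.card_erase_add_one]
      simp [hi, hlt]
    rw [koszulSign, koszulSign, koszulSign, koszulSign, h1, h2]
    ring
  rcases lt_or_gt_of_ne hij with h | h
  · exact key hi h
  · rw [add_comm]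
    exact key hj h

theorem koszulBoundary_koszulBoundary (y : ℕ → R) (w : Finset ℕ → M) (S : Finset ℕ) :
    koszulBoundary y (koszulBoundary y w) S = 0 := by
  simp only [koszulBoundary, Finset.smul_sum]
  rw [Finset.sum_sigma']
  refine Finset.sum_involution (fun p _ => ⟨p.2, p.1⟩) ?_ ?_ ?_ ?_
  · rintro ⟨j, i⟩ h
    simp only [Finset.mem_sigma, Finset.mem_erase] at h
    simp only [smul_smul]
    rw [Finset.erase_right_comm, ← add_smul]
    have := koszulSign_swap (R := R) h.2.2 h.1 h.2.1
    convert zero_smul R _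
    linear_combination (y i * y j) * this
  · rintro ⟨j, i⟩ h _ heq
    simp only [Finset.mem_sigma, Finset.mem_erase] at h
    simp only [Sigma.mk.injEq, heq_eq_eq] at heq
    exact h.2.1 heq.1
  · rintro ⟨j, i⟩ h
    simp only [Finset.mem_sigma, Finset.mem_erase] at h ⊢
    exact ⟨h.2.2, h.2.1.symm, h.1⟩
  · rintro ⟨j, i⟩ h
    rfl

end Koszul

variable {V k : Type*} [Field k]

theorem mem_of_forall_single {r : ℕ} {J : Ideal (MvPolynomial V k)}
    (f : (Fin r → MvPolynomial V k) →ₗ[MvPolynomial V k] MvPolynomial V k)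
    (h : ∀ l, f (Pi.single l 1) ∈ J) (v : Fin r → MvPolynomial V k) : f v ∈ J := by
  rw [LinearMap.pi_apply_eq_sum_univ f v]
  refine Submodule.sum_mem _ fun l _ => Submodule.smul_mem _ _ ?_
  convert h l using 2
  ext1 j
  simp [Pi.single_apply, eq_comm]

namespace MinimalFreeResolution

/-- The Koszul complex on linear forms `y j` annihilating `aug m` maps to a resolution. -/
theorem exists_koszul_lift {M : Type*} [AddCommGroup M] [Module (MvPolynomial V k) M]
    {gr : ℤ → AddSubgroup M} (F : MinimalFreeResolution V k M gr) (y : ℕ → MvPolynomial V k)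
    (hy : ∀ j, y j ∈ homogeneousPart V k 1) {E : ℤ} (m : Fin (F.rank 0) → MvPolynomial V k)
    (hm : IsHom (F.deg 0) E m) (hym : ∀ j, y j • F.aug m = 0) :
    ∃ φ : ∀ i, Finset ℕ → Fin (F.rank i) → MvPolynomial V k, φ 0 ∅ = m ∧
      (∀ i S, S.card = i → IsHom (F.deg i) (E + i) (φ i S)) ∧
      ∀ i S, S.card = i + 1 → F.d i (φ (i + 1) S) = koszulBoundary y (φ i) S := by
  have hd : ∀ i l, IsHom (F.deg i) (F.deg (i + 1) l) (F.d i (Pi.single l 1)) :=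
    fun i l n => F.d_homogeneous i l n
  have hsign : ∀ j S, koszulSign (MvPolynomial V k) j S ∈ homogeneousPart V k 0 := by
    intro j S
    rcases neg_one_pow_eq_or (MvPolynomial V k) (S.filter (· < j)).card with h | h
    · rw [koszulSign, h]
      exact one_mem_homogeneousPart
    · rw [koszulSign, h]
      exact neg_mem one_mem_homogeneousPart
  -- The invariant is that the family is homogeneous and its Koszul boundary can be lifted through
  -- `F.d i`. Only sets of cardinality `i` matter; values elsewhere are arbitrary.
  let T : ℕ → Type _ := fun i => {φ : Finset ℕ → Fin (F.rank i) → MvPolynomial V k //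
    (∀ S, S.card = i → IsHom (F.deg i) (E + i) (φ S)) ∧
      ∀ S, S.card = i + 1 → koszulBoundary y φ S ∈ LinearMap.range (F.d i)}
  let t₀ : T 0 := ⟨fun _ => m, fun S _ => by simpa using hm, fun S _ => by
    rw [F.exact_zero, LinearMap.mem_ker, map_koszulBoundary]
    refine Finset.sum_eq_zero fun j _ => ?_
    rw [mul_smul, hym, smul_zero]⟩
  obtain ⟨f, hf0, hf⟩ := exists_seq_of_step (T := T) (R := fun i t t' =>
    ∀ S, S.card = i + 1 → F.d i (t'.1 S) = koszulBoundary y t.1 S) t₀ (by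
    rintro i ⟨φ, hφ, hφ'⟩
    have hex : ∀ S, ∃ v, S.card = i + 1 → F.d i v = koszulBoundary y φ S := fun S => by
      by_cases h : S.card = i + 1
      · exact (hφ' S h).imp fun v hv _ => hv
      · exact ⟨0, fun h' => (h h').elim⟩
    choose v hv using hex
    have hhom : ∀ S, S.card = i + 1 →
        IsHom (F.deg i) (E + (i + 1 : ℕ)) (koszulBoundary y φ S) := by
      intro S hS
      refine IsHom.sum _ fun j hj => ?_
      have h := (hφ (S.erase j) (by rw [Finset.card_erase_of_mem hj, hS]; rfl)).smul
        (mul_mem_homogeneousPart (hsign j S) (hy j))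
      convert h using 1
      push_cast
      ring
    have hdv : ∀ S, S.card = i + 1 →
        F.d i (vecComponent (F.deg (i + 1)) (E + (i + 1 : ℕ)) (v S)) = koszulBoundary y φ S := by
      intro S hS
      rw [map_vecComponent (hd i), hv S hS, (hhom S hS).vecComponent_eq]
    refine ⟨⟨fun S => vecComponent (F.deg (i + 1)) (E + (i + 1 : ℕ)) (v S),
      fun S _ => isHom_vecComponent _ _, fun S hS => ?_⟩, hdv⟩
    rw [F.exact_succ, LinearMap.mem_ker, map_koszulBoundary,
      ← koszulBoundary_koszulBoundary y φ S]
    refine koszulBoundary_congr y fun j hj => hdv _ ?_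
    rw [Finset.card_erase_of_mem hj, hS]
    rfl)
  exact ⟨fun i => (f i).1, congrFun (congrArg Subtype.val hf0) ∅, fun i => (f i).2.1, hf⟩

end MinimalFreeResolution

/-! ### Monomials modulo the complete intersection -/

section Monomials

variable {q : ℕ} (a b : Fin q → V)

/-- The exponents of the monomials `X (a j) * X (b j)` with `i ≤ j`, and of the variables which
are not among the `X (a j)` and `X (b j)`. -/
def pairExponents (i : ℕ) : Set (V →₀ ℕ) :=
  {s | ∃ j : Fin q, i ≤ j ∧ s = Finsupp.single (a j) 1 + Finsupp.single (b j) 1} ∪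
    {s | ∃ u, u ∉ Set.range a ∧ u ∉ Set.range b ∧ s = Finsupp.single u 1}

/-- The complete intersection generated by the monomials `X (a j) * X (b j)` with `i ≤ j`, and by
the variables which are not among the `X (a j)` and `X (b j)`. -/
noncomputable def pairIdeal (k : Type*) [Field k] (i : ℕ) : Ideal (MvPolynomial V k) :=
  Ideal.span ((fun s => monomial s (1 : k)) '' pairExponents a b i)

/-- The exponent of the monomial `∏_{i ≤ j} X (b j)`. -/
noncomputable def tailExponent (i : ℕ) : V →₀ ℕ :=
  ∑ j ∈ Finset.univ.filter (fun j : Fin q => i ≤ (j : ℕ)), Finsupp.single (b j) 1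

variable {a b}

theorem coeff_eq_zero_of_mem_pairIdeal {i : ℕ} {p : MvPolynomial V k} (hp : p ∈ pairIdeal a b k i)
    {m : V →₀ ℕ} (hm : ∀ s ∈ pairExponents a b i, ¬ s ≤ m) : p.coeff m = 0 := by
  by_contra h
  obtain ⟨s, hs, hsm⟩ := mem_ideal_span_monomial_image.mp hp m (mem_support_iff.mpr h)
  exact hm s hs hsm

theorem pairExponents_eq_insert (i : Fin q) : pairExponents a b i =
    insert (Finsupp.single (a i) 1 + Finsupp.single (b i) 1) (pairExponents a b (i + 1)) := by
  ext s
  simp only [pairExponents, Set.mem_union, Set.mem_ofPred_eq, Set.mem_insert_iff, ← or_assoc]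
  refine or_congr_left ⟨?_, ?_⟩
  · rintro ⟨j, hj, rfl⟩
    rcases hj.eq_or_lt with h | h
    · exact Or.inl (by rw [Fin.ext h])
    · exact Or.inr ⟨j, h, rfl⟩
  · rintro (rfl | ⟨j, hj, rfl⟩)
    · exact ⟨i, le_rfl, rfl⟩
    · exact ⟨j, by omega, rfl⟩

theorem exists_sub_mem_pairIdeal (i : Fin q) {p : MvPolynomial V k} (hp : p ∈ pairIdeal a b k i) :
    ∃ c, p - X (a i) * X (b i) * c ∈ pairIdeal a b k (i + 1) := by
  rw [pairIdeal, pairExponents_eq_insert, Set.image_insert_eq, Ideal.mem_span_insert] at hp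
  obtain ⟨c, z, hz, rfl⟩ := hp
  refine ⟨c, ?_⟩
  have h : monomial (Finsupp.single (a i) 1 + Finsupp.single (b i) 1) (1 : k) =
      X (a i) * X (b i) := by
    simp [X, monomial_mul]
  rw [h, mul_comm c, add_sub_cancel_left]
  exact hz

theorem apply_eq_zero_of_mem_pairExponents (ha : a.Injective) (hb : b.Injective)
    (hab : ∀ i j, a i ≠ b j) (i : Fin q) {s : V →₀ ℕ} (hs : s ∈ pairExponents a b (i + 1)) :
    s (a i) = 0 ∧ s (b i) = 0 := by
  classical
  rcases hs with ⟨j, hj, rfl⟩ | ⟨u, hu, hu', rfl⟩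
  · have hij : j ≠ i := by
      rintro rfl
      omega
    simp [ha.eq_iff, hb.eq_iff, hab, (hab _ _).symm, hij]
  · have h1 : u ≠ a i := fun h => hu ⟨i, h.symm⟩
    have h2 : u ≠ b i := fun h => hu' ⟨i, h.symm⟩
    simp [h1, h2]

/-- The regular sequence property: no generator of the later ideal involves `a i` or `b i`, so
cancelling these variables preserves divisibility by a generator. -/
theorem mem_pairIdeal_of_mul_mem (ha : a.Injective) (hb : b.Injective)
    (hab : ∀ i j, a i ≠ b j) (i : Fin q) {p : MvPolynomial V k}
    (hp : X (a i) * X (b i) * p ∈ pairIdeal a b k (i + 1)) : p ∈ pairIdeal a b k (i + 1) := by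
  classical
  refine mem_ideal_span_monomial_image.mpr fun m hm => ?_
  obtain ⟨s, hs, hsm⟩ := mem_ideal_span_monomial_image.mp hp
    (Finsupp.single (a i) 1 + (Finsupp.single (b i) 1 + m)) (by
      rw [mem_support_iff, mul_assoc, coeff_X_mul, coeff_X_mul]
      exact mem_support_iff.mp hm)
  obtain ⟨h1, h2⟩ := apply_eq_zero_of_mem_pairExponents ha hb hab i hs
  refine ⟨s, hs, fun v => ?_⟩
  by_cases hva : v = a i
  · simp [hva, h1]
  by_cases hvb : v = b i
  · simp [hvb, h2]
  simpa [Finsupp.single_apply, Ne.symm hva, Ne.symm hvb] using hsm v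

theorem tailExponent_eq_add (i : Fin q) :
    tailExponent b i = Finsupp.single (b i) 1 + tailExponent b (i + 1) := by
  classical
  have : (Finset.univ.filter fun j : Fin q => (i : ℕ) ≤ (j : ℕ)) =
      insert i (Finset.univ.filter fun j : Fin q => (i : ℕ) + 1 ≤ (j : ℕ)) := by
    ext j
    simp only [Finset.mem_filter, Finset.mem_univ, true_and, Finset.mem_insert, Fin.ext_iff]
    omega
  rw [tailExponent, this, Finset.sum_insert (by simp), tailExponent]

theorem tailExponent_apply_eq_zero {v : V} (hv : v ∉ Set.range b) (i : ℕ) :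
    tailExponent b i v = 0 := by
  classical
  rw [tailExponent, Finsupp.finsetSum_apply]
  exact Finset.sum_eq_zero fun j _ => Finsupp.single_eq_of_ne fun h => hv ⟨j, h.symm⟩

/-- A generator needs some `a j` with `i ≤ j` or an unmatched variable, and the exponent contains
neither. Coefficients at such exponents are therefore well defined modulo `pairIdeal a b k i`. -/
theorem not_le_of_mem_pairExponents (ha : a.Injective) (hab : ∀ i j, a i ≠ b j)
    {i i' : ℕ} {n : V →₀ ℕ} {s : V →₀ ℕ} (hs : s ∈ pairExponents a b i)
    (hn : ∀ v, v ∉ Set.range b → n v ≠ 0 → ∃ j : Fin q, (j : ℕ) < i ∧ v = a j) :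
    ¬ s ≤ tailExponent b i' + n := by
  classical
  intro hle
  rcases hs with ⟨j, hj, rfl⟩ | ⟨u, hu, hu', rfl⟩
  · have hr : a j ∉ Set.range b := fun ⟨j', h⟩ => hab _ _ h.symm
    have h := hle (a j)
    rw [Finsupp.add_apply, Finsupp.add_apply, tailExponent_apply_eq_zero hr,
      Finsupp.single_eq_same] at h
    obtain ⟨j', hj', h'⟩ := hn _ hr (by omega)
    rw [← ha h'] at hj'
    omega
  · have h := hle u
    rw [Finsupp.add_apply, tailExponent_apply_eq_zero hu', Finsupp.single_eq_same] at h
    obtain ⟨j', hj', h'⟩ := hn _ hu' (by omega)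
    exact hu ⟨j', h'.symm⟩

end Monomials

/-! ### Comparison maps and the generator of degree `2 * q` -/

namespace MinimalFreeResolution

/-- The comparison maps from a resolution of `R / I` to the complete intersection `pairIdeal`. -/
theorem exists_comparison {I : Ideal (MvPolynomial V k)}
    (F : MinimalFreeResolution V k (MvPolynomial V k ⧸ I) (quotientPart I))
    {q : ℕ} {a b : Fin q → V} (ha : a.Injective) (hb : b.Injective) (hab : ∀ i j, a i ≠ b j)
    (ψ₀ : (Fin (F.rank 0) → MvPolynomial V k) →ₗ[MvPolynomial V k] MvPolynomial V k)
    (hψ₀ : ∀ v, ψ₀ (F.d 0 v) ∈ pairIdeal a b k 0) :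
    ∃ ψ : ∀ i, (Fin (F.rank i) → MvPolynomial V k) →ₗ[MvPolynomial V k] MvPolynomial V k,
      ψ 0 = ψ₀ ∧ ∀ (i : Fin q) (v : Fin (F.rank (i + 1)) → MvPolynomial V k),
        ψ i (F.d i v) - X (a i) * X (b i) * ψ (i + 1) v ∈ pairIdeal a b k (i + 1) := by
  let T : ℕ → Type _ := fun i =>
    {ψ : (Fin (F.rank i) → MvPolynomial V k) →ₗ[MvPolynomial V k] MvPolynomial V k //
      ∀ v, ψ (F.d i v) ∈ pairIdeal a b k i}
  have hdd : ∀ i v, F.d i (F.d (i + 1) v) = 0 := fun i v => by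
    rw [← LinearMap.mem_ker, ← F.exact_succ]
    exact ⟨v, rfl⟩
  obtain ⟨f, hf0, hf⟩ := exists_seq_of_step (T := T) (R := fun i t t' => ∀ h : i < q, ∀ v,
    t.1 (F.d i v) - X (a ⟨i, h⟩) * X (b ⟨i, h⟩) * t'.1 v ∈ pairIdeal a b k (i + 1))
    ⟨ψ₀, hψ₀⟩ (by
    rintro i ⟨ψ, hψ⟩
    by_cases hi : i < q
    · choose c hc using fun l : Fin (F.rank (i + 1)) =>
        exists_sub_mem_pairIdeal ⟨i, hi⟩ (hψ (Pi.single l 1))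
      have key : ∀ v, ψ (F.d i v) - X (a ⟨i, hi⟩) * X (b ⟨i, hi⟩) *
          Fintype.linearCombination (MvPolynomial V k) c v ∈ pairIdeal a b k (i + 1) := by
        refine mem_of_forall_single (ψ ∘ₗ F.d i -
          (X (a ⟨i, hi⟩) * X (b ⟨i, hi⟩) : MvPolynomial V k) •
          Fintype.linearCombination (MvPolynomial V k) c) fun l => ?_
        simpa [Fintype.linearCombination_apply_single] using hc l
      refine ⟨⟨Fintype.linearCombination (MvPolynomial V k) c, fun v => ?_⟩, fun _ => key⟩
      -- On a boundary the first term of `key` vanishes, and the remaining factor `X (a i) * X (b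
      -- i)` cancels modulo the later generators.
      refine mem_pairIdeal_of_mul_mem ha hb hab ⟨i, hi⟩ ?_
      have := key (F.d (i + 1) v)
      rw [hdd, map_zero, zero_sub] at this
      exact neg_mem_iff.mp this
    · exact ⟨⟨0, fun v => by simp⟩, fun h => (hi h).elim⟩)
  exact ⟨fun i => (f i).1, congrArg Subtype.val hf0, fun i v => hf i i.2 v⟩

/-- `F` is an arbitrary resolution, so `F 0` need not literally be `R`; this map replaces that
identification. -/
theorem exists_graded_lift {I : Ideal (MvPolynomial V k)}
    (F : MinimalFreeResolution V k (MvPolynomial V k ⧸ I) (quotientPart I)) :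
    ∃ ψ : (Fin (F.rank 0) → MvPolynomial V k) →ₗ[MvPolynomial V k] MvPolynomial V k,
      (∀ l, ψ (Pi.single l 1) ∈ homogeneousPart V k (F.deg 0 l)) ∧
        ∀ v, Ideal.Quotient.mk I (ψ v) = F.aug v := by
  choose p hp hp' using F.aug_homogeneous
  have h1 : ∀ l, Fintype.linearCombination (MvPolynomial V k) p (Pi.single l 1) = p l := fun l => by
    rw [Fintype.linearCombination_apply_single, one_smul]
  refine ⟨Fintype.linearCombination (MvPolynomial V k) p, fun l => by rw [h1]; exact hp l, ?_⟩
  have : I.mkQ ∘ₗ Fintype.linearCombination (MvPolynomial V k) p = F.aug := by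
    refine LinearMap.pi_ext' fun l => LinearMap.ext_ring ?_
    simpa [h1] using! hp' l
  exact fun v => LinearMap.congr_fun this v

/-- If `I` is contained in the complete intersection `pairIdeal a b k 0`, and the class of
`∏ j, X (b j)` in `R / I` is annihilated by the variables `X (a j)`, then the `q`-th module in a
minimal graded free resolution of `R / I` has a generator of degree `2 * q`. -/
theorem exists_deg_eq_two_mul {I : Ideal (MvPolynomial V k)}
    (F : MinimalFreeResolution V k (MvPolynomial V k ⧸ I) (quotientPart I))
    (hI : ∀ p ∈ I, ∀ D, component D p ∈ I)
    {q : ℕ} {a b : Fin q → V} (ha : a.Injective) (hb : b.Injective) (hab : ∀ i j, a i ≠ b j)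
    (hIJ : I ≤ pairIdeal a b k 0) (hx : ∀ j, X (a j) * ∏ i, X (b i) ∈ I) :
    ∃ l, F.deg q l = 2 * q := by
  classical
  obtain ⟨ψ₀, hψ₀h, hψ₀⟩ := F.exists_graded_lift
  have hker : ∀ v, F.aug v = 0 ↔ ψ₀ v ∈ I := fun v => by
    rw [← hψ₀, Ideal.Quotient.eq_zero_iff_mem]
  have haugd : ∀ v, F.aug (F.d 0 v) = 0 := fun v => by
    rw [← LinearMap.mem_ker, ← F.exact_zero]
    exact ⟨v, rfl⟩
  obtain ⟨ψ, hψ0, hψ⟩ := F.exists_comparison ha hb hab ψ₀ fun v => hIJ ((hker _).mp (haugd v))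
  have hprod : ∏ i, X (b i) = monomial (tailExponent b 0) (1 : k) := by
    rw [tailExponent, monomial_sum_one]
    simp [X]
  have hdeg : (tailExponent b 0).degree = q := by
    simp [tailExponent]
  set xB : MvPolynomial V k := ∏ i, X (b i) with hxB
  have hxBh : xB ∈ homogeneousPart V k q := by
    have := monomial_mem_homogeneousPart (tailExponent b 0) (1 : k)
    rwa [hdeg, ← hprod] at this
  obtain ⟨m', hm'⟩ := F.aug_surjective (Ideal.Quotient.mk I xB)
  set m := vecComponent (F.deg 0) q m' with hmdef
  have hmI : ψ₀ m - xB ∈ I := by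
    have h1 : ψ₀ m' - xB ∈ I := by
      rw [← Ideal.Quotient.eq, hψ₀, hm']
    have := hI _ h1 q
    rwa [map_sub, ← map_vecComponent_ring hψ₀h, component_self hxBh] at this
  let y : ℕ → MvPolynomial V k := fun j => if h : j < q then X (a ⟨j, h⟩) else 0
  have hyX : ∀ j : Fin q, y j = X (a j) := fun j => by simp [y]
  have hy : ∀ j, y j ∈ homogeneousPart V k 1 := fun j => by
    by_cases h : j < q
    · rw [hyX ⟨j, h⟩]
      exact X_mem_homogeneousPart _
    · simp only [y, dif_neg h]
      exact zero_mem _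
  obtain ⟨φ, hφ0, hφh, hφ⟩ := F.exists_koszul_lift y hy m (isHom_vecComponent _ _) (by
    intro j
    by_cases h : j < q
    · rw [hyX ⟨j, h⟩, ← map_smul, hker, map_smul, smul_eq_mul]
      have := add_mem (I.mul_mem_left (X (a ⟨j, h⟩)) hmI) (hx ⟨j, h⟩)
      convert this using 1
      ring
    · simp [y, h])
  -- At stage `i` the factors `X (b j)` with `j < i` have been used up; at `i = q` the tracked
  -- monomial is `1`.
  have hcoeff : ∀ i, i ≤ q →
      (ψ i (φ i (Finset.range i))).coeff (tailExponent b i) ≠ 0 := by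
    intro i
    induction i with
    | zero =>
      intro _
      have h := coeff_eq_zero_of_mem_pairIdeal (hIJ hmI) (m := tailExponent b 0) fun s hs => by
        simpa using not_le_of_mem_pairExponents (n := 0) ha hab hs (by simp)
      rw [coeff_sub, sub_eq_zero] at h
      rw [Finset.range_zero, hφ0, hψ0, h, hprod, coeff_monomial, if_pos rfl]
      exact one_ne_zero
    | succ i ih =>
      intro hi
      obtain ⟨j, rfl⟩ : ∃ j : Fin q, (j : ℕ) = i := ⟨⟨i, hi⟩, rfl⟩
      -- The comparison relation is read off at `X (a j)` times the current tail: dividing by `X (a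
      -- j) * X (b j)` leaves the next tail.
      have h := coeff_eq_zero_of_mem_pairIdeal (hψ j (φ (j + 1) (Finset.range (j + 1))))
        (m := Finsupp.single (a j) 1 + tailExponent b j) fun s hs => by
          rw [add_comm]
          refine not_le_of_mem_pairExponents ha hab hs fun v _ hv => ⟨j, by simp, ?_⟩
          by_contra hne
          exact hv (Finsupp.single_eq_of_ne hne)
      rw [coeff_sub, sub_eq_zero, mul_assoc, coeff_X_mul, tailExponent_eq_add,
        coeff_X_mul] at h
      -- Only the face omitting `j` contributes: any other term carries a factor `X (a c)` with `c ≠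
      -- j`, absent from the monomial.
      rw [← h, hφ _ _ (by simp), map_koszulBoundary, koszulBoundary, coeff_sum,
        ← tailExponent_eq_add, Finset.sum_eq_single (j : ℕ)]
      · have hr : (Finset.range ((j : ℕ) + 1)).erase j = Finset.range j := by
          rw [Finset.range_add_one, Finset.erase_insert (by simp)]
        rw [hr, smul_eq_mul, hyX, mul_assoc, koszulSign]
        rcases neg_one_pow_eq_or (MvPolynomial V k)
          ((Finset.range ((j : ℕ) + 1)).filter (· < (j : ℕ))).card with h' | h'
        · rw [h', one_mul, coeff_X_mul]
          exact ih j.2.le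
        · rw [h', neg_one_mul, coeff_neg, coeff_X_mul, neg_ne_zero]
          exact ih j.2.le
      · intro c hc hcj
        have hcq : c < q := by
          have := Finset.mem_range.mp hc
          omega
        rw [hyX ⟨c, hcq⟩, smul_eq_mul, mul_assoc, mul_left_comm, coeff_X_mul', if_neg]
        rw [Finsupp.mem_support_iff, not_not, Finsupp.add_apply,
          tailExponent_apply_eq_zero fun ⟨j', h'⟩ => hab _ _ h'.symm, add_zero]
        refine Finsupp.single_eq_of_ne fun h' => hcj ?_
        exact congrArg Fin.val (ha h')
      · simp
  have hq := hcoeff q le_rfl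
  have h0 : tailExponent b q = 0 := by
    rw [tailExponent, Finset.filter_false_of_mem, Finset.sum_empty]
    intro j _
    have := j.2
    omega
  rw [h0] at hq
  by_contra! hne
  refine hq ?_
  -- The vector has degree `q + q`, so a coordinate with nonzero constant term must sit at a basis
  -- vector of degree `2 * q`.
  have hzero : ∀ l, constantCoeff (φ q (Finset.range q) l) = 0 := fun l => by
    by_contra hl
    have := hφh q _ (Finset.card_range q) l 0 (by rwa [← constantCoeff_eq])
    apply hne l
    simp at this
    omega
  rw [← constantCoeff_eq, LinearMap.pi_apply_eq_sum_univ, map_sum]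
  exact Finset.sum_eq_zero fun l _ => by rw [smul_eq_mul, map_mul, hzero, zero_mul]

end MinimalFreeResolution

end GradedReg

/-! ### Minimal resolutions and projective dimension -/

namespace GradedReg

open MvPolynomial CategoryTheory

universe u v

theorem hasProjectiveDimensionLT_ker {R : Type u} [CommRing R] [Small.{v} R] {M N : Type v}
    [AddCommGroup M] [Module R M] [AddCommGroup N] [Module R N] [Module.Projective R M]
    (f : M →ₗ[R] N) (hf : Function.Surjective f) (n : ℕ)
    (h : HasProjectiveDimensionLT (ModuleCat.of R N) (n + 2)) :
    HasProjectiveDimensionLT (ModuleCat.of R (LinearMap.ker f)) (n + 1) :=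
  ((LinearMap.shortExact_shortComplexKer hf).hasProjectiveDimensionLT_X₃_iff n
    ((IsProjective.iff_projective M).mp inferInstance)).mp h

variable {V : Type u} {k : Type v} [Field k]

/-- A direct summand of a free module which is contained in the maximal graded ideal times the
free module is zero. -/
theorem eq_bot_of_retract [Finite V] {r : ℕ}
    {N : Submodule (MvPolynomial V k) (Fin r → MvPolynomial V k)}
    (hN : ∀ v ∈ N, ∀ l, constantCoeff (v l) = 0)
    (ρ : (Fin r → MvPolynomial V k) →ₗ[MvPolynomial V k] (Fin r → MvPolynomial V k))
    (hρ : ∀ v, ρ v ∈ N) (hρN : ∀ v ∈ N, ρ v = v) : N = ⊥ := by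
  -- Expanding `v = ρ v` in the basis gives `N ⊆ 𝔪N`. Nakayama yields `p ≡ 1` mod `𝔪` killing `N`,
  -- and torsion-freeness of the free module replaces localization.
  have hle : N ≤ RingHom.ker (constantCoeff (R := k) (σ := V)) • N := by
    intro v hv
    rw [← hρN v hv, LinearMap.pi_apply_eq_sum_univ ρ v]
    exact Submodule.sum_mem _ fun l _ => Submodule.smul_mem_smul (hN v hv l) (hρ _)
  obtain ⟨p, hp, hpN⟩ := Submodule.exists_sub_one_mem_and_smul_eq_zero_of_fg_of_le_smul _ N
    (IsNoetherian.noetherian N) hle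
  rw [eq_bot_iff]
  intro v hv
  have hp0 : p ≠ 0 := by
    rintro rfl
    rw [RingHom.mem_ker, map_sub, map_zero, map_one, zero_sub, neg_eq_zero] at hp
    exact one_ne_zero hp
  exact (smul_eq_zero.mp (hpN v hv)).resolve_left hp0

/-- A projective target splits `f`, so the kernel is a direct summand inside `𝔪` times the free
module. -/
theorem ker_eq_bot_of_hasProjectiveDimensionLT_one [Finite V] {r : ℕ} {M : Type (max u v)}
    [AddCommGroup M] [Module (MvPolynomial V k) M]
    (f : (Fin r → MvPolynomial V k) →ₗ[MvPolynomial V k] M) (hf : Function.Surjective f)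
    (hker : ∀ v ∈ LinearMap.ker f, ∀ l, constantCoeff (v l) = 0)
    (h : HasProjectiveDimensionLT (ModuleCat.of (MvPolynomial V k) M) 1) :
    LinearMap.ker f = ⊥ := by
  have hproj : Module.Projective (MvPolynomial V k) M := by
    rw [← projective_iff_hasProjectiveDimensionLT_one, ← IsProjective.iff_projective] at h
    exact h
  obtain ⟨s, hs⟩ := Module.projective_lifting_property f LinearMap.id hf
  have hs' : ∀ x, f (s x) = x := fun x => LinearMap.congr_fun hs x
  refine eq_bot_of_retract hker (LinearMap.id - s ∘ₗ f) (fun v => ?_) fun v hv => ?_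
  · simp [hs']
  · simp [LinearMap.mem_ker.mp hv]

namespace MinimalFreeResolution

section

variable {M : Type*} [AddCommGroup M] [Module (MvPolynomial V k) M] {gr : ℤ → AddSubgroup M}
  (F : MinimalFreeResolution V k M gr)

theorem constantCoeff_eq_zero_of_mem_range (i : ℕ) {w : Fin (F.rank i) → MvPolynomial V k}
    (hw : w ∈ LinearMap.range (F.d i)) (m : Fin (F.rank i)) : constantCoeff (w m) = 0 := by
  obtain ⟨v, rfl⟩ := hw
  exact mem_of_forall_single (J := RingHom.ker constantCoeff)
    (LinearMap.proj (φ := fun _ => MvPolynomial V k) m ∘ₗ F.d i)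
    (fun l => RingHom.mem_ker.mpr (F.minimal i l m)) v

theorem rank_eq_zero_of_range_eq_top (i : ℕ) (h : LinearMap.range (F.d i) = ⊤) :
    F.rank i = 0 := by
  by_contra hr
  have := F.constantCoeff_eq_zero_of_mem_range i (w := Pi.single ⟨0, Nat.pos_of_ne_zero hr⟩ 1)
    (h ▸ Submodule.mem_top) ⟨0, Nat.pos_of_ne_zero hr⟩
  simp at this

theorem rank_succ_eq_zero_of_range_eq_bot (i : ℕ) (h : LinearMap.range (F.d i) = ⊥) :
    F.rank (i + 1) = 0 := by
  refine F.rank_eq_zero_of_range_eq_top _ ?_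
  rw [F.exact_succ, LinearMap.range_eq_bot.mp h, LinearMap.ker_zero]

end

/-- Dimension shifting along the syzygies reaches a projective one. Its minimal cover has zero
kernel, so the next module of the resolution vanishes. -/
theorem rank_eq_zero_of_hasProjectiveDimensionLT_range [Finite V] {M : Type (max u v)}
    [AddCommGroup M] [Module (MvPolynomial V k) M] {gr : ℤ → AddSubgroup M}
    (F : MinimalFreeResolution V k M gr) (n i : ℕ)
    (h : HasProjectiveDimensionLT
      (ModuleCat.of (MvPolynomial V k) (LinearMap.range (F.d i))) (n + 1)) :
    F.rank (i + n + 2) = 0 := by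
  induction n generalizing i with
  | zero =>
    refine F.rank_succ_eq_zero_of_range_eq_bot (i + 1) ?_
    have h' := ker_eq_bot_of_hasProjectiveDimensionLT_one (F.d i).rangeRestrict
      (F.d i).surjective_rangeRestrict (fun v hv => by
        rw [LinearMap.ker_rangeRestrict, ← F.exact_succ] at hv
        exact F.constantCoeff_eq_zero_of_mem_range _ hv) h
    rwa [LinearMap.ker_rangeRestrict, ← F.exact_succ] at h'
  | succ n ih =>
    have h' := hasProjectiveDimensionLT_ker (F.d i).rangeRestrict
      (F.d i).surjective_rangeRestrict n h
    rw [LinearMap.ker_rangeRestrict, ← F.exact_succ] at h'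
    rw [show i + (n + 1) + 2 = (i + 1) + n + 2 by ring]
    exact ih (i + 1) h'

theorem rank_eq_zero_of_hasProjectiveDimensionLT [Finite V] {M : Type (max u v)} [AddCommGroup M]
    [Module (MvPolynomial V k) M] {gr : ℤ → AddSubgroup M}
    (F : MinimalFreeResolution V k M gr) (q : ℕ)
    (h : HasProjectiveDimensionLT (ModuleCat.of (MvPolynomial V k) M) q) : F.rank q = 0 := by
  match q with
  | 0 =>
    rw [hasProjectiveDimensionLT_zero_iff_isZero, ModuleCat.isZero_iff_subsingleton] at h
    have : Subsingleton M := h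
    refine F.rank_eq_zero_of_range_eq_top _ ?_
    rw [F.exact_zero, eq_top_iff]
    exact fun v _ => Subsingleton.elim _ _
  | 1 =>
    refine F.rank_succ_eq_zero_of_range_eq_bot 0 ?_
    rw [F.exact_zero]
    refine ker_eq_bot_of_hasProjectiveDimensionLT_one F.aug F.aug_surjective (fun v hv => ?_) h
    rw [← F.exact_zero] at hv
    exact F.constantCoeff_eq_zero_of_mem_range _ hv
  | n + 2 =>
    have h' := hasProjectiveDimensionLT_ker F.aug F.aug_surjective n h
    rw [← F.exact_zero] at h'
    simpa using F.rank_eq_zero_of_hasProjectiveDimensionLT_range n 0 h'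

end MinimalFreeResolution

theorem component_mem_span {S : Set (MvPolynomial V k)}
    (hS : ∀ g ∈ S, ∃ d, g ∈ homogeneousPart V k d) {p : MvPolynomial V k}
    (hp : p ∈ Ideal.span S) (D : ℤ) : component D p ∈ Ideal.span S := by
  -- The arbitrary multiplier `c` lets the span induction pass through scalar multiplication.
  suffices h : ∀ c : MvPolynomial V k, component D (c * p) ∈ Ideal.span S by simpa using h 1
  induction hp using Submodule.span_induction with
  | mem g hg =>
    intro c
    obtain ⟨d, hd⟩ := hS g hg
    rw [component_mul c hd]
    exact Ideal.mul_mem_left _ _ (Ideal.subset_span hg)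
  | zero => simp
  | add x y _ _ hx hy =>
    intro c
    rw [mul_add, map_add]
    exact add_mem (hx c) (hy c)
  | smul a x _ hx =>
    intro c
    rw [smul_eq_mul, ← mul_assoc]
    exact hx _

theorem prod_X_mem_homogeneousPart (S : Finset V) :
    (∏ w ∈ S, X w : MvPolynomial V k) ∈ homogeneousPart V k S.card := by
  classical
  induction S using Finset.induction_on with
  | empty => simpa using! one_mem_homogeneousPart
  | insert w S hw ih =>
    rw [Finset.prod_insert hw, Finset.card_insert_of_notMem hw, add_comm]
    push_cast
    exact mul_mem_homogeneousPart (X_mem_homogeneousPart w) ih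

end GradedReg

/-! ### Closed neighborhood ideals and the main theorem -/

namespace SimpleGraph

open GradedReg MvPolynomial

universe u v

variable {V : Type u} [Fintype V] {k : Type v} [Field k] {G : SimpleGraph V}

theorem component_mem_closedNeighborhoodIdeal {p : MvPolynomial V k}
    (hp : p ∈ G.closedNeighborhoodIdeal k) (D : ℤ) :
    component D p ∈ G.closedNeighborhoodIdeal k := by
  refine component_mem_span ?_ hp D
  rintro _ ⟨v, rfl⟩
  exact ⟨_, prod_X_mem_homogeneousPart _⟩

theorem constantCoeff_eq_zero_of_mem_closedNeighborhoodIdeal {p : MvPolynomial V k}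
    (hp : p ∈ G.closedNeighborhoodIdeal k) : constantCoeff p = 0 := by
  have hle : G.closedNeighborhoodIdeal k ≤ RingHom.ker constantCoeff := by
    refine Ideal.span_le.mpr ?_
    rintro _ ⟨v, rfl⟩
    rw [SetLike.mem_coe, RingHom.mem_ker, map_prod]
    exact Finset.prod_eq_zero (i := v) (by simp) (constantCoeff_X k v)
  exact hle hp

theorem prod_X_mem_closedNeighborhoodIdeal {S : Finset V} (v : V) (hv : v ∈ S)
    (hS : ∀ w, G.Adj v w → w ∈ S) :
    (∏ w ∈ S, X w : MvPolynomial V k) ∈ G.closedNeighborhoodIdeal k := by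
  classical
  refine Ideal.mem_of_dvd _ (Finset.prod_dvd_prod_of_subset _ S _ ?_)
    (Ideal.subset_span ⟨v, rfl⟩)
  intro w hw
  rcases (Finset.mem_filter.mp hw).2 with rfl | h
  · exact hv
  · exact hS w h

/-- For a matched vertex, `N[v]` contains its whole pair; for an unmatched one, the variable of `v`
itself divides the generator. -/
theorem closedNeighborhoodIdeal_le_pairIdeal {q : ℕ} {a b : Fin q → V}
    (hadj : ∀ j, G.Adj (b j) (a j)) :
    G.closedNeighborhoodIdeal k ≤ pairIdeal a b k 0 := by
  classical
  refine Ideal.span_le.mpr ?_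
  rintro _ ⟨v, rfl⟩
  have hpair : ∀ j : Fin q, ∏ w ∈ {a j, b j}, X w ∈ pairIdeal a b k 0 := fun j =>
    Ideal.subset_span ⟨_, Or.inl ⟨j, Nat.zero_le _, rfl⟩, by
      rw [Finset.prod_pair (hadj j).ne', X, X, monomial_mul, one_mul]⟩
  by_cases ha : v ∈ Set.range a
  · obtain ⟨j, rfl⟩ := ha
    refine Ideal.mem_of_dvd _ (Finset.prod_dvd_prod_of_subset _ _ _ ?_) (hpair j)
    intro w hw
    rcases Finset.mem_insert.mp hw with rfl | hw
    · simp
    · simp [Finset.mem_singleton.mp hw, (hadj j).symm]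
  by_cases hb : v ∈ Set.range b
  · obtain ⟨j, rfl⟩ := hb
    refine Ideal.mem_of_dvd _ (Finset.prod_dvd_prod_of_subset _ _ _ ?_) (hpair j)
    intro w hw
    rcases Finset.mem_insert.mp hw with rfl | hw
    · simp [hadj j]
    · simp [Finset.mem_singleton.mp hw]
  · refine Ideal.mem_of_dvd _ (Finset.dvd_prod_of_mem _ (a := v) (by simp)) ?_
    exact Ideal.subset_span ⟨_, Or.inr ⟨v, ha, hb, rfl⟩, rfl⟩

/-- For a graph `G` with a vertex cover of `q` vertices matched into its complement, the `q`-th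
module of a minimal graded free resolution of `R / NI(G)` has a generator of degree `2 * q`. -/
theorem exists_deg_eq_two_mul {B : Finset V} {α : V → V} (hinj : Set.InjOn α B)
    (hnot : ∀ b ∈ B, α b ∉ B) (hadj : ∀ b ∈ B, G.Adj b (α b)) (hB : G.IsVertexCover B)
    (F : MinimalFreeResolution V k (MvPolynomial V k ⧸ G.closedNeighborhoodIdeal k)
      (quotientPart (G.closedNeighborhoodIdeal k))) :
    ∃ l, F.deg B.card l = 2 * B.card := by
  classical
  let e := B.equivFin.symm
  have he : Function.Injective fun j => (e j : V) := Subtype.val_injective.comp e.injective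
  refine F.exists_deg_eq_two_mul (fun p hp D => component_mem_closedNeighborhoodIdeal hp D)
    (a := fun j => α (e j)) (b := fun j => e j) (fun i j h => he (hinj (e i).2 (e j).2 h)) he
    (fun i j h => hnot _ (e i).2 (h ▸ (e j).2))
    (closedNeighborhoodIdeal_le_pairIdeal fun j => hadj _ (e j).2) fun j => ?_
  have hprod : ∏ i, X (e i : V) = ∏ w ∈ B, (X w : MvPolynomial V k) := by
    rw [← Finset.prod_coe_sort B]
    exact Equiv.prod_comp e fun w : B => (X (w : V) : MvPolynomial V k)
  rw [hprod, ← Finset.prod_insert (hnot _ (e j).2)]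
  refine prod_X_mem_closedNeighborhoodIdeal (α (e j)) (Finset.mem_insert_self _ _) fun w hw => ?_
  -- `α (e j)` is outside the cover, so all its neighbors lie in `B`.
  exact Finset.mem_insert_of_mem ((hB hw).resolve_left (hnot _ (e j).2))

end SimpleGraph

theorem theorem2p3 {V : Type*} [Fintype V] (k : Type*) [Field k]
    (G : SimpleGraph V) (hG : G.IsAcyclic) :
    ((G.matchingNum : ℕ) : EReal) ≤
        GradedReg.regularity V k (MvPolynomial V k ⧸ G.closedNeighborhoodIdeal k)
          (GradedReg.quotientPart (G.closedNeighborhoodIdeal k)) ∧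
      ((G.matchingNum : ℕ) : WithBot ℕ∞) ≤
        CategoryTheory.projectiveDimension
          (ModuleCat.of (MvPolynomial V k)
            (MvPolynomial V k ⧸ G.closedNeighborhoodIdeal k)) := by
  obtain ⟨B, α, hinj, hnot, hadj, hB⟩ := hG.exists_isVertexCover_matched
  have hle : G.matchingNum ≤ B.card := hB.matchingNum_le
  obtain ⟨F⟩ := GradedReg.nonempty_minimalFreeResolution (I := G.closedNeighborhoodIdeal k)
    (fun p hp D => SimpleGraph.component_mem_closedNeighborhoodIdeal hp D)
    (fun p hp => SimpleGraph.constantCoeff_eq_zero_of_mem_closedNeighborhoodIdeal hp)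
  obtain ⟨l, hl⟩ := SimpleGraph.exists_deg_eq_two_mul hinj hnot hadj hB F
  constructor
  · refine le_trans ?_ (le_iSup_of_le F (le_iSup_of_le B.card (le_iSup_of_le l le_rfl)))
    rw [hl, show (2 * (B.card : ℤ) - B.card : ℤ) = (B.card : ℤ) by ring, Int.cast_natCast,
      EReal.coe_coe_eq_natCast]
    exact_mod_cast hle
  · refine le_trans (b := ((B.card : ℕ) : WithBot ℕ∞)) (by exact_mod_cast hle) ?_
    rw [CategoryTheory.projectiveDimension_ge_iff]
    intro h
    have h0 := F.rank_eq_zero_of_hasProjectiveDimensionLT B.card h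
    -- The generator `l` found above contradicts rank zero.
    exact (Fin.cast h0 l).elim0
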